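/- Notation. Let $r\ge 1$ be an integer and $1\le p\le\infty$ (with $\frac1\infty:=0$). Write $l_0(\mathbb Z)^{s\times t}$ for the finitely supported sequences $u:\mathbb Z\to\mathbb C^{s\times t}$, put $\widehat u(\xi):=\sum_{k\in\mathbb Z}u(k)e^{-ik\xi}$, and $(l_0(\mathbb Z))^r:=l_0(\mathbb Z)^{r\times 1}$. For smooth $f,g$ and an integer $m\ge0$, $f(\xi)=g(\xi)+O(|\xi|^{m})$ as $\xi\to0$ means $f^{(j)}(0)=g^{(j)}(0)$ for all $0\le j<m$ (no condition if $m=0$). A mask $a\in l_0(\mathbb Z)^{r\times r}$ has order $m$ sum rules with a matching filter $v\in l_0(\mathbb Z)^{1\times r}$ if $\widehat v(0)\ne0$ and, as $\xi\to0$, $$\widehat v(2\xi)\widehat a(\xi)=\widehat v(\xi)+O(|\xi|^m),\qquad \widehat v(2\xi)\widehat a(\xi+\pi)=O(|\xi|^m).$$ Let $\operatorname{sr}(a)$ be the largest integer $m\ge 0$ such that $a$ has order $m$ sum rules with some matching filter. The subdivision operator is $(\mathcal S_aw)(j):=2\sum_{k\in\mathbb Z}w(k)a(j-2k)$, $\boldsymbol\delta$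 is the Dirac sequence ($\boldsymbol\delta(0)=1$, $\boldsymbol\delta(k)=0$ for $k\neq0$), and $(w*u)(j):=\sum_{k\in\mathbb Z}w(j-k)u(k)$. For an integer $j\ge 0$ and $v\in l_0(\mathbb Z)^{1\times r}$ define $$\rho_j(a,v)_p:=\sup\Big\{\limsup_{n\to\infty}\big\|(\mathcal S_a^n(\boldsymbol\delta I_r))*u\big\|_{(l_p(\mathbb Z))^r}^{1/n}\;:\;u\in(l_0(\mathbb Z))^r,\ \widehat v(\xi)\widehat u(\xi)=O(|\xi|^j),\ \xi\to0\Big\},$$ and $$\operatorname{sm}_p(a,v):=\tfrac1p-\log_2\rho_{\operatorname{sr}(a)}(a,v)_p\in[-\infty,\infty]\qquad(\log_2 0:=-\infty).$$ Theorem. Let $a\in l_0(\mathbb Z)^{r\times r}$ have order $\operatorname{sr}(a)$ sum rules with a matching filter $\vartheta_a\in l_0(\mathbb Z)^{1\times r}$. Then $\operatorname{sm}_p(a,\vartheta_a)$ does not depend on the choice of $\vartheta_a$: if $a$ also has order $\operatorname{sr}(a)$ sum rules with a matching filter $\vartheta_a'$, then $\operatorname{sm}_p(a,\vartheta_a)=\operatorname{sm}_p(a,\vartheta_a')$.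 Moreover, $$\rho_k(a,v)_p=2^{\frac1p-\operatorname{sm}_p(a,\vartheta_a)},\qquad\text{equivalently}\qquad \operatorname{sm}_p(a,\vartheta_a)=\tfrac1p-\log_2\rho_k(a,v)_p,$$ for every $v\in l_0(\mathbb Z)^{1\times r}$ with $\widehat v(0)\ne0$ and every integer $k\ge0$ with $\operatorname{sm}_p(a,\vartheta_a)\le k\le\operatorname{sr}(a)$ such that $a$ has order $k$ sum rules with the matching filter $v$. -/

import Mathlib

namespace VectorSubdivision

open Filter MeasureTheory
open scoped ENNReal Matrix

noncomputable section

/-- Finitely supported matrix masks `a : ℤ → ℂ^{r × r}`. -/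
abbrev Mask (r : ℕ) := ℤ →₀ Matrix (Fin r) (Fin r) ℂ

/-- Finitely supported vector sequences `ℤ → ℂ^r`. Used both for filters (row vectors,
multiplied from the left) and for sequences in `(l_0(ℤ))^r` (column vectors). -/
abbrev VecSeq (r : ℕ) := ℤ →₀ (Fin r → ℂ)

/-- The symbol (Fourier series) `û(ξ) = ∑_k u(k) e^{-ikξ}` of a finitely supported sequence. -/
def symbol {M : Type*} [AddCommGroup M] [Module ℂ M] (u : ℤ →₀ M) (ξ : ℝ) : M :=
  u.sum fun k x => Complex.exp (-Complex.I * (k : ℂ) * (ξ : ℂ)) • x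

/-- `f(ξ) = g(ξ) + O(|ξ|^m)` as `ξ → 0`, for smooth functions `f` and `g`, in the sense that
the derivatives of `f` and `g` at `0` of all orders `0, …, m - 1` agree (no condition if
`m = 0`). -/
def AgreeToOrder {E : Type*} [NormedAddCommGroup E] [NormedSpace ℝ E]
    (m : ℕ) (f g : ℝ → E) : Prop :=
  ∀ j < m, iteratedDeriv j f 0 = iteratedDeriv j g 0

/-- The mask `a` has order `m` sum rules with the matching filter `v`: `v̂(0) ≠ 0`,
`v̂(2ξ) â(ξ) = v̂(ξ) + O(|ξ|^m)` and `v̂(2ξ) â(ξ + π) = O(|ξ|^m)` as `ξ → 0`. -/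
structure HasSumRules {r : ℕ} (a : Mask r) (v : VecSeq r) (m : ℕ) : Prop where
  symbol_zero_ne : symbol v 0 ≠ 0
  matching : AgreeToOrder m (fun ξ => symbol v (2 * ξ) ᵥ* symbol a ξ) (fun ξ => symbol v ξ)
  vanishing : AgreeToOrder m (fun ξ => symbol v (2 * ξ) ᵥ* symbol a (ξ + Real.pi)) (fun _ => 0)

/-- `sr(a)`: the largest `m` such that `a` has order `m` sum rules with some matching filter. -/
def sr {r : ℕ} (a : Mask r) : ℕ :=
  sSup {m : ℕ | ∃ v : VecSeq r, HasSumRules a v m}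

/-- The subdivision operator `(S_a w)(j) = 2 ∑_k w(k) a(j - 2k)`. -/
def subdivision {s r : ℕ} (a : Mask r) (w : ℤ → Matrix (Fin s) (Fin r) ℂ) :
    ℤ → Matrix (Fin s) (Fin r) ℂ :=
  fun j => (2 : ℂ) • ∑ᶠ k : ℤ, w k * a (j - 2 * k)

/-- The Dirac sequence `δ I_r`. -/
def dirac (r : ℕ) : ℤ → Matrix (Fin r) (Fin r) ℂ :=
  fun k => if k = 0 then 1 else 0

/-- The convolution `(w * u)(j) = ∑_k w(j - k) u(k)`. -/
def conv {s r : ℕ} (w : ℤ → Matrix (Fin s) (Fin r) ℂ) (u : VecSeq r) : ℤ → Fin s → ℂ :=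
  fun j => u.sum fun k x => w (j - k) *ᵥ x

/-- The norm of `(l_p(ℤ))^r`. -/
def lpNorm {r : ℕ} (p : ℝ≥0∞) (w : ℤ → Fin r → ℂ) : ℝ≥0∞ :=
  eLpNorm (fun q : ℤ × Fin r => w q.1 q.2) p Measure.count

/-- The space of all `u ∈ (l_0(ℤ))^r` with `v̂(ξ) û(ξ) = O(|ξ|^j)` as `ξ → 0`. -/
def vanishingSpace {r : ℕ} (j : ℕ) (v : VecSeq r) : Set (VecSeq r) :=
  {u | AgreeToOrder j (fun ξ => symbol v ξ ⬝ᵥ symbol u ξ) (fun _ => 0)}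

/-- `ρ_j(a, v)_p`: the supremum of `limsup_n ‖(S_a^n (δ I_r)) * u‖_p ^ (1/n)` over all
`u ∈ (l_0(ℤ))^r` with `v̂(ξ) û(ξ) = O(|ξ|^j)`. -/
def rho {r : ℕ} (j : ℕ) (a : Mask r) (v : VecSeq r) (p : ℝ≥0∞) : ℝ≥0∞ :=
  ⨆ u ∈ vanishingSpace j v,
    limsup (fun n : ℕ => lpNorm p (conv ((subdivision a)^[n] (dirac r)) u) ^ (1 / (n : ℝ))) atTop

/-- The binary logarithm `[0, ∞] → [-∞, ∞]`, with `log₂ 0 = -∞` and `log₂ ∞ = ∞`. -/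
def log2 (x : ℝ≥0∞) : EReal := ENNReal.log x / (Real.log 2 : ℝ)

/-- `2 ^ x` for `x ∈ [-∞, ∞]`, with `2 ^ (-∞) = 0` and `2 ^ ∞ = ∞`. -/
def exp2 (x : EReal) : ℝ≥0∞ := EReal.exp (x * (Real.log 2 : ℝ))

/-- The exponent `1 / p`, with `1 / ∞ = 0`. -/
def recip (p : ℝ≥0∞) : EReal := ((1 / p : ℝ≥0∞) : EReal)

/-- `sm_p(a, v) = 1/p - log₂ ρ_{sr(a)}(a, v)_p`, an element of `[-∞, ∞]`
(it is `∞` exactly if `ρ_{sr(a)}(a, v)_p = 0`). -/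
def sm {r : ℕ} (a : Mask r) (v : VecSeq r) (p : ℝ≥0∞) : EReal :=
  recip p - log2 (rho (sr a) a v p)

end

end VectorSubdivision

/-! Write V_j(v) for the space of `u` with v̂û = O(|ξ|^j). The entries of (S_a^(n+1) δ) * u of
parity γ are (S_a^n δ) * (coset γ of u), so everything is governed by two operators `coset a 0` and
`coset a 1`. Under order m sum rules they preserve V_j(v) for j ≤ m, and for j < m both act on
V_j(v)/V_(j+1)(v) as the scalar 2^(-j) (`pairingCoeff_coset`).

Since interleaving two equal sequences multiplies the l_p norm by 2^(1/p), this layer has rate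
2^(1/p-j). From above, ρ_j ≤ max(ρ_(j+1), 2^(1/p-j)) (`rho_le_max_succ`); from below, every `u` in
V_j(v) outside V_(j+1)(v) grows at least at that rate (`rate_le_growth`).

For two filters v, v' of order k, either V_k(v) ⊆ V_k(v'), or there is a largest j < k with V_k(v) ⊆
V_j(v'). By symmetry of such inclusions (`vanishingSpace_subset_symm`), some `u` in V_k(v') then
lies in V_j(v) but not in V_(j+1)(v), so the rate 2^(1/p-j) lost in passing from k to j is already
present in ρ_k(a, v'). Hence ρ_k is independent of the filter (`rho_eq_rho`). Finally sm ≤ k says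
2^(1/p-k) ≤ ρ_sr, so lowering the order from sr(a) to k does not change ρ. -/

namespace VectorSubdivision

open Filter MeasureTheory
open scoped Matrix ContDiff

noncomputable section

/-! ### Taylor series at the origin -/

/-- The Taylor series at `0` of a function on the real line. -/
def jet (f : ℝ → ℂ) : PowerSeries ℂ :=
  PowerSeries.mk fun n => iteratedDeriv n f 0 / (n.factorial : ℂ)

lemma coeff_jet (f : ℝ → ℂ) (n : ℕ) :
    PowerSeries.coeff n (jet f) = iteratedDeriv n f 0 / (n.factorial : ℂ) :=
  PowerSeries.coeff_mk _ _

lemma jet_mul {f g : ℝ → ℂ} (hf : ContDiff ℝ ∞ f) (hg : ContDiff ℝ ∞ g) :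
    jet (fun x => f x * g x) = jet f * jet g := by
  ext n
  rw [PowerSeries.coeff_mul, coeff_jet]
  have hfn : ContDiffAt ℝ n f 0 := (hf.of_le (mod_cast le_top)).contDiffAt
  have hgn : ContDiffAt ℝ n g 0 := (hg.of_le (mod_cast le_top)).contDiffAt
  rw [iteratedDeriv_fun_mul hfn hgn,
    Finset.Nat.sum_antidiagonal_eq_sum_range_succ_mk, Finset.sum_div]
  refine Finset.sum_congr rfl fun i hi => ?_
  have hi' : i ≤ n := Nat.lt_succ_iff.mp (Finset.mem_range.mp hi)
  rw [coeff_jet, coeff_jet, Nat.cast_choose ℂ hi']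
  have := Nat.cast_ne_zero (R := ℂ).mpr n.factorial_ne_zero
  field_simp

lemma jet_add {f g : ℝ → ℂ} (hf : ContDiff ℝ ∞ f) (hg : ContDiff ℝ ∞ g) :
    jet (fun x => f x + g x) = jet f + jet g := by
  ext n
  have hfn : ContDiffAt ℝ n f 0 := (hf.of_le (mod_cast le_top)).contDiffAt
  have hgn : ContDiffAt ℝ n g 0 := (hg.of_le (mod_cast le_top)).contDiffAt
  rw [map_add, coeff_jet, coeff_jet, coeff_jet, iteratedDeriv_fun_add hfn hgn, add_div]

lemma jet_sub {f g : ℝ → ℂ} (hf : ContDiff ℝ ∞ f) (hg : ContDiff ℝ ∞ g) :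
    jet (fun x => f x - g x) = jet f - jet g := by
  ext n
  have hfn : ContDiffAt ℝ n f 0 := (hf.of_le (mod_cast le_top)).contDiffAt
  have hgn : ContDiffAt ℝ n g 0 := (hg.of_le (mod_cast le_top)).contDiffAt
  rw [map_sub, coeff_jet, coeff_jet, coeff_jet, iteratedDeriv_fun_sub hfn hgn, sub_div]

lemma jet_const_mul (c : ℂ) (f : ℝ → ℂ) : jet (fun x => c * f x) = c • jet f := by
  ext n
  rw [PowerSeries.coeff_smul, coeff_jet, coeff_jet, iteratedDeriv_const_mul_field, mul_div_assoc,
    smul_eq_mul]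

lemma jet_comp_mul {f : ℝ → ℂ} (hf : ContDiff ℝ ∞ f) (c : ℝ) :
    jet (fun x => f (c * x)) = PowerSeries.rescale (c : ℂ) (jet f) := by
  ext n
  have h := iteratedDeriv_comp_const_smul (hf.of_le (mod_cast le_top : (n : WithTop ℕ∞) ≤ ∞)) c
  rw [PowerSeries.coeff_rescale, coeff_jet, coeff_jet, h]
  simp [mul_div_assoc]

lemma constantCoeff_jet (f : ℝ → ℂ) : PowerSeries.constantCoeff (jet f) = f 0 := by
  rw [← PowerSeries.coeff_zero_eq_constantCoeff_apply, coeff_jet]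
  simp

lemma agreeToOrder_zero_iff (m : ℕ) (f : ℝ → ℂ) :
    AgreeToOrder m f (fun _ => 0) ↔ PowerSeries.X ^ m ∣ jet f := by
  rw [PowerSeries.X_pow_dvd_iff]
  refine forall₂_congr fun j _ => ?_
  rw [coeff_jet, iteratedDeriv_fun_const_zero, div_eq_zero_iff]
  simp [Nat.factorial_ne_zero]

lemma iteratedDeriv_apply {r : ℕ} {f : ℝ → Fin r → ℂ} (hf : ContDiff ℝ ∞ f) (i : Fin r) (n : ℕ) :
    iteratedDeriv n f 0 i = iteratedDeriv n (fun x => f x i) 0 := by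
  have h := (ContinuousLinearMap.proj (R := ℝ) (φ := fun _ : Fin r => ℂ) i).iteratedFDeriv_comp_left
    (hf.contDiffAt (x := 0)) (i := n) (mod_cast le_top)
  rw [iteratedDeriv, iteratedDeriv]
  have h2 := congrArg (fun L => L fun _ => (1 : ℝ)) h
  exact h2.symm

lemma AgreeToOrder.dvd_jet_sub {r m : ℕ} {f g : ℝ → Fin r → ℂ} (h : AgreeToOrder m f g)
    (hf : ContDiff ℝ ∞ f) (hg : ContDiff ℝ ∞ g) (i : Fin r) :
    PowerSeries.X ^ m ∣ jet (fun x => f x i) - jet (fun x => g x i) := by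
  rw [PowerSeries.X_pow_dvd_iff]
  intro j hj
  rw [map_sub, coeff_jet, coeff_jet, ← iteratedDeriv_apply hf, ← iteratedDeriv_apply hg, h j hj,
    sub_self]

/-! ### Smoothness and linearity of Fourier symbols -/

section symbol

variable {M : Type*} [AddCommGroup M] [Module ℂ M]

/-- The Fourier series at a fixed frequency, as a linear map. -/
def symbolₗ (M : Type*) [AddCommGroup M] [Module ℂ M] (ξ : ℝ) : (ℤ →₀ M) →ₗ[ℂ] M :=
  Finsupp.lsum ℂ fun k => Complex.exp (-Complex.I * (k : ℂ) * (ξ : ℂ)) • LinearMap.id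

lemma symbolₗ_apply (u : ℤ →₀ M) (ξ : ℝ) : symbolₗ M ξ u = symbol u ξ :=
  rfl

lemma symbol_add (u w : ℤ →₀ M) (ξ : ℝ) : symbol (u + w) ξ = symbol u ξ + symbol w ξ := by
  simp [← symbolₗ_apply]

lemma symbol_smul (c : ℂ) (u : ℤ →₀ M) (ξ : ℝ) : symbol (c • u) ξ = c • symbol u ξ := by
  simp [← symbolₗ_apply]

lemma symbol_single (k : ℤ) (x : M) (ξ : ℝ) :
    symbol (Finsupp.single k x) ξ = Complex.exp (-Complex.I * (k : ℂ) * (ξ : ℂ)) • x := by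
  simp [symbol]

lemma symbol_map {N : Type*} [AddCommGroup N] [Module ℂ N] (φ : M →ₗ[ℂ] N) (u : ℤ →₀ M)
    (ξ : ℝ) : symbol (u.mapRange φ (map_zero φ)) ξ = φ (symbol u ξ) := by
  rw [symbol, symbol, Finsupp.sum_mapRange_index (by simp), Finsupp.sum, Finsupp.sum, map_sum]
  simp

lemma contDiff_exp_mul (c : ℂ) : ContDiff ℝ ∞ fun ξ : ℝ => Complex.exp (c * (ξ : ℂ)) :=
  (contDiff_const.mul Complex.ofRealCLM.contDiff).cexp

lemma contDiff_symbol {M : Type*} [NormedAddCommGroup M] [NormedSpace ℂ M] (u : ℤ →₀ M) :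
    ContDiff ℝ ∞ (symbol u) := by
  unfold symbol Finsupp.sum
  exact ContDiff.sum fun k _ => (contDiff_exp_mul _).smul contDiff_const

lemma contDiff_symbol_apply {r : ℕ} (u : VecSeq r) (i : Fin r) :
    ContDiff ℝ ∞ fun ξ => symbol u ξ i :=
  contDiff_pi.mp (contDiff_symbol u) i

lemma contDiff_symbol_mask {r : ℕ} (a : Mask r) (i j : Fin r) :
    ContDiff ℝ ∞ fun ξ => symbol a ξ i j := by
  have h : (fun ξ => symbol a ξ i j) =
      fun ξ : ℝ => ∑ k ∈ a.support, Complex.exp (-Complex.I * (k : ℂ) * (ξ : ℂ)) * a k i j := by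
    funext ξ
    simp [symbol, Finsupp.sum, Matrix.sum_apply]
  rw [h]
  exact ContDiff.sum fun k _ => (contDiff_exp_mul _).mul contDiff_const

end symbol

lemma contDiff_dotProduct {r : ℕ} {f g : ℝ → Fin r → ℂ} (hf : ContDiff ℝ ∞ f)
    (hg : ContDiff ℝ ∞ g) : ContDiff ℝ ∞ fun ξ => f ξ ⬝ᵥ g ξ :=
  ContDiff.sum fun i _ => (contDiff_pi.mp hf i).mul (contDiff_pi.mp hg i)

lemma jet_dotProduct {r : ℕ} {f g : ℝ → Fin r → ℂ} (hf : ContDiff ℝ ∞ f)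
    (hg : ContDiff ℝ ∞ g) :
    jet (fun ξ => f ξ ⬝ᵥ g ξ) = ∑ i, jet (fun ξ => f ξ i) * jet (fun ξ => g ξ i) := by
  have hf' := contDiff_pi.mp hf
  have hg' := contDiff_pi.mp hg
  simp only [← jet_mul (hf' _) (hg' _)]
  ext n
  rw [coeff_jet]
  have h := iteratedDeriv_fun_sum (I := Finset.univ) (n := n) (x := (0 : ℝ)) (𝕜 := ℝ)
    (f := fun i ξ => f ξ i * g ξ i) fun i _ =>
      (((hf' i).mul (hg' i)).of_le (mod_cast le_top)).contDiffAt
  simp only [dotProduct, map_sum, coeff_jet, h, Finset.sum_div]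

/-! ### Vanishing spaces and their comparison for two filters -/

/-- The Taylor series at `0` of the scalar symbol `v̂ û`. -/
def pairing {r : ℕ} (v u : VecSeq r) : PowerSeries ℂ :=
  jet fun ξ => symbol v ξ ⬝ᵥ symbol u ξ

lemma mem_vanishingSpace {r j : ℕ} {v u : VecSeq r} :
    u ∈ vanishingSpace j v ↔ PowerSeries.X ^ j ∣ pairing v u :=
  agreeToOrder_zero_iff _ _

lemma pairing_eq_sum {r : ℕ} (v u : VecSeq r) :
    pairing v u = ∑ i, jet (fun ξ => symbol v ξ i) * jet (fun ξ => symbol u ξ i) :=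
  jet_dotProduct (contDiff_symbol v) (contDiff_symbol u)

lemma pairing_add {r : ℕ} (v u w : VecSeq r) :
    pairing v (u + w) = pairing v u + pairing v w := by
  unfold pairing
  rw [← jet_add (contDiff_dotProduct (contDiff_symbol v) (contDiff_symbol u))
    (contDiff_dotProduct (contDiff_symbol v) (contDiff_symbol w))]
  simp only [symbol_add, dotProduct_add]

lemma pairing_smul {r : ℕ} (v : VecSeq r) (c : ℂ) (u : VecSeq r) :
    pairing v (c • u) = c • pairing v u := by
  unfold pairing
  rw [← jet_const_mul]
  simp only [symbol_smul, dotProduct_smul, smul_eq_mul]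

/-- The coefficient of `ξ ^ j` in `v̂ û`, as a linear functional of `u`. -/
def pairingCoeff {r : ℕ} (j : ℕ) (v : VecSeq r) : VecSeq r →ₗ[ℂ] ℂ where
  toFun u := PowerSeries.coeff j (pairing v u)
  map_add' u w := by rw [pairing_add, map_add]
  map_smul' c u := by rw [pairing_smul, PowerSeries.coeff_smul]; rfl

lemma pairingCoeff_apply {r : ℕ} (j : ℕ) (v u : VecSeq r) :
    pairingCoeff j v u = PowerSeries.coeff j (pairing v u) := rfl

lemma mem_vanishingSpace_iff_pairingCoeff {r j : ℕ} {v u : VecSeq r} :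
    u ∈ vanishingSpace j v ↔ ∀ i < j, pairingCoeff i v u = 0 := by
  rw [mem_vanishingSpace, PowerSeries.X_pow_dvd_iff]
  rfl

lemma vanishingSpace_anti {r : ℕ} (v : VecSeq r) {j k : ℕ} (h : j ≤ k) :
    vanishingSpace k v ⊆ vanishingSpace j v := fun _ hu =>
  mem_vanishingSpace.mpr ((pow_dvd_pow _ h).trans (mem_vanishingSpace.mp hu))

/-- If every `u` with `v̂ û = O(|ξ|^k)` satisfies `v̂' û = O(|ξ|^j)`, then the `2 × 2` minors of
`(v̂, v̂')` are `O(|ξ|^j)`, and the inclusion also holds with `v` and `v'` interchanged. -/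
lemma vanishingSpace_subset_symm {r j k : ℕ} {v v' : VecSeq r} (hjk : j ≤ k)
    (hv' : symbol v' 0 ≠ 0) (h : vanishingSpace k v ⊆ vanishingSpace j v') :
    vanishingSpace k v' ⊆ vanishingSpace j v := by
  set V : Fin r → PowerSeries ℂ := fun i => jet fun ξ => symbol v ξ i with hV
  set V' : Fin r → PowerSeries ℂ := fun i => jet fun ξ => symbol v' ξ i with hV'
  have minor : ∀ b c, PowerSeries.X ^ j ∣ V' b * V c - V' c * V b := by
    intro b c
    -- The test sequence with û = v̂_c e_b − v̂_b e_c is annihilated by v̂ identically, and its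
    -- pairing with v̂' is exactly the minor.
    let φ : (Fin r → ℂ) →ₗ[ℂ] (Fin r → ℂ) :=
      (LinearMap.proj c).smulRight (Pi.single b 1) - (LinearMap.proj b).smulRight (Pi.single c 1)
    let u : VecSeq r := v.mapRange φ (map_zero φ)
    have hu : ∀ ξ, symbol u ξ =
        symbol v ξ c • Pi.single b 1 - symbol v ξ b • Pi.single c 1 := fun ξ => symbol_map φ v ξ
    have h1 : u ∈ vanishingSpace k v := by
      rw [mem_vanishingSpace, pairing]
      have : (fun ξ => symbol v ξ ⬝ᵥ symbol u ξ) = fun _ => 0 := by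
        funext ξ
        rw [hu]
        simp [mul_comm]
      rw [this, ← agreeToOrder_zero_iff]
      exact fun _ _ => rfl
    have h2 := mem_vanishingSpace.mp (h h1)
    have h3 : pairing v' u = V' b * V c - V' c * V b := by
      rw [hV, hV', ← jet_mul (contDiff_symbol_apply _ _) (contDiff_symbol_apply _ _),
        ← jet_mul (contDiff_symbol_apply _ _) (contDiff_symbol_apply _ _),
        ← jet_sub ((contDiff_symbol_apply _ _).mul (contDiff_symbol_apply _ _))
          ((contDiff_symbol_apply _ _).mul (contDiff_symbol_apply _ _)), pairing]
      congr 1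
      funext ξ
      rw [hu]
      simp [mul_comm]
    rwa [h3] at h2
  intro u hu
  rw [mem_vanishingSpace] at hu ⊢
  -- A component of v̂' that is nonzero at 0 is an invertible power series, so multiplying by it
  -- does not affect divisibility by `X ^ j`.
  obtain ⟨b, hb⟩ := Function.ne_iff.mp hv'
  have hunit : IsUnit (V' b) := by
    rw [PowerSeries.isUnit_iff_constantCoeff, constantCoeff_jet]
    exact isUnit_iff_ne_zero.mpr hb
  rw [← hunit.dvd_mul_left]
  have h1 : V' b * pairing v u =
      V b * pairing v' u + ∑ c, (V' b * V c - V' c * V b) * jet (fun ξ => symbol u ξ c) := by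
    rw [pairing_eq_sum, pairing_eq_sum, Finset.mul_sum, Finset.mul_sum, ← Finset.sum_add_distrib]
    exact Finset.sum_congr rfl fun c _ => by ring
  rw [h1]
  exact dvd_add (((pow_dvd_pow _ hjk).trans hu).mul_left _)
    (Finset.dvd_sum fun c _ => (minor b c).mul_right _)

end

end VectorSubdivision

namespace VectorSubdivision

open Filter MeasureTheory
open scoped Matrix ContDiff

noncomputable section

/-! ### Coset operators and the sum rules -/

/-- The coset `i ↦ 2 (a * u)(2 i + γ)` of the convolution `2 a * u`. -/
def coset {r : ℕ} (a : Mask r) (γ : ℤ) (u : VecSeq r) : VecSeq r :=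
  a.sum fun l A => u.sum fun k x =>
    if 2 ∣ l + k - γ then Finsupp.single ((l + k - γ) / 2) ((2 : ℂ) • A *ᵥ x) else 0

lemma exp_add_pi (s : ℤ) (ξ : ℝ) :
    Complex.exp (-Complex.I * (s : ℂ) * ((ξ + Real.pi : ℝ) : ℂ)) =
      (if 2 ∣ s then 1 else -1) * Complex.exp (-Complex.I * (s : ℂ) * (ξ : ℂ)) := by
  have h : -Complex.I * (s : ℂ) * ((ξ + Real.pi : ℝ) : ℂ) =
      -Complex.I * (s : ℂ) * (ξ : ℂ) + (-s : ℤ) * (Real.pi * Complex.I) := by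
    push_cast
    ring
  rw [h, Complex.exp_add, Complex.exp_int_mul, Complex.exp_pi_mul_I, mul_comm]
  congr 1
  split_ifs with hs
  · exact Even.neg_one_zpow (even_neg.mpr (even_iff_two_dvd.mpr hs))
  · rw [← even_iff_two_dvd, Int.not_even_iff_odd] at hs
    exact Odd.neg_one_zpow (odd_neg.mpr hs)

lemma symbol_mulVec_symbol {r : ℕ} (a : Mask r) (u : VecSeq r) (ξ : ℝ) :
    symbol a ξ *ᵥ symbol u ξ = a.sum fun l A => u.sum fun k x =>
      Complex.exp (-Complex.I * ((l + k : ℤ) : ℂ) * (ξ : ℂ)) • A *ᵥ x := by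
  simp only [symbol, Finsupp.sum, Matrix.sum_mulVec, Matrix.mulVec_sum]
  rw [Finset.sum_comm]
  refine Finset.sum_congr rfl fun l _ => Finset.sum_congr rfl fun k _ => ?_
  rw [Matrix.smul_mulVec, Matrix.mulVec_smul, smul_smul, ← Complex.exp_add]
  congr 2
  push_cast
  ring

/-- The shift by π changes the sign of the terms with l + k − γ odd, so the sum cancels them and
doubles the others; this is the factor 2 in `coset`. -/
lemma symbol_coset {r : ℕ} (a : Mask r) (γ : ℤ) (u : VecSeq r) (ξ : ℝ) :
    symbol (coset a γ u) (2 * ξ) =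
      Complex.exp (Complex.I * (γ : ℂ) * (ξ : ℂ)) • symbol a ξ *ᵥ symbol u ξ +
      Complex.exp (Complex.I * (γ : ℂ) * ((ξ + Real.pi : ℝ) : ℂ)) •
        symbol a (ξ + Real.pi) *ᵥ symbol u (ξ + Real.pi) := by
  rw [symbol_mulVec_symbol, symbol_mulVec_symbol, ← symbolₗ_apply, coset]
  simp only [Finsupp.sum, map_sum, Finset.smul_sum, ← Finset.sum_add_distrib]
  refine Finset.sum_congr rfl fun l _ => Finset.sum_congr rfl fun k _ => ?_
  have h : ∀ t : ℝ, Complex.exp (Complex.I * (γ : ℂ) * (t : ℂ)) *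
      Complex.exp (-Complex.I * ((l + k : ℤ) : ℂ) * (t : ℂ)) =
      Complex.exp (-Complex.I * ((l + k - γ : ℤ) : ℂ) * (t : ℂ)) := fun t => by
    rw [← Complex.exp_add]
    congr 1
    push_cast
    ring
  rw [smul_smul, smul_smul, h, h, ← add_smul, exp_add_pi]
  split_ifs with hs
  · obtain ⟨t, ht⟩ := hs
    rw [ht, Int.mul_ediv_cancel_left t two_ne_zero, symbolₗ_apply, symbol_single, smul_smul]
    congr 1
    rw [one_mul, ← two_mul, mul_comm]
    congr 2
    push_cast
    ring
  · simp

lemma subdivision_apply {s r : ℕ} (a : Mask r) (w : ℤ → Matrix (Fin s) (Fin r) ℂ) (j : ℤ) :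
    subdivision a w j =
      (2 : ℂ) • a.sum fun l A => if 2 ∣ j - l then w ((j - l) / 2) * A else 0 := by
  rw [subdivision]
  congr 1
  rw [Finsupp.sum, ← Finset.sum_filter]
  have inj : Set.InjOn (fun l : ℤ => (j - l) / 2) (a.support.filter fun l => 2 ∣ j - l) := by
    intro l hl l' hl' h
    simp only [Finset.coe_filter, Set.mem_ofPred_eq] at hl hl' h
    omega
  rw [finsum_eq_sum_of_support_subset (s := (a.support.filter fun l => 2 ∣ j - l).image
    fun l => (j - l) / 2), Finset.sum_image inj]
  · refine Finset.sum_congr rfl fun l hl => ?_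
    have := (Finset.mem_filter.mp hl).2
    congr 2
    omega
  · intro k hk
    have hk' : a (j - 2 * k) ≠ 0 := fun h => hk (by simp [h])
    simp only [Finset.coe_image, Finset.coe_filter, Set.mem_image, Set.mem_ofPred_eq]
    exact ⟨j - 2 * k, ⟨Finsupp.mem_support_iff.mpr hk', by omega⟩, by omega⟩

/-- Convolution with a fixed left factor, as a linear map. -/
def convₗ {s r : ℕ} (w : ℤ → Matrix (Fin s) (Fin r) ℂ) : VecSeq r →ₗ[ℂ] ℤ → Fin s → ℂ :=
  Finsupp.lsum ℂ fun k => LinearMap.pi fun j => (w (j - k)).mulVecLin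

lemma convₗ_apply {s r : ℕ} (w : ℤ → Matrix (Fin s) (Fin r) ℂ) (u : VecSeq r) :
    convₗ w u = conv w u := by
  funext j
  simp [convₗ, conv, Finsupp.sum, Finset.sum_apply]

/-- This moves one subdivision step from `w` onto `u`, which permits induction on the number of
steps with `u` varying. -/
lemma conv_subdivision {s r : ℕ} (a : Mask r) (w : ℤ → Matrix (Fin s) (Fin r) ℂ) (u : VecSeq r)
    (γ i : ℤ) : conv (subdivision a w) u (2 * i + γ) = conv w (coset a γ u) i := by
  rw [← convₗ_apply w, coset]
  simp only [Finsupp.sum, map_sum, Finset.sum_apply]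
  rw [conv, Finsupp.sum, Finset.sum_comm]
  refine Finset.sum_congr rfl fun k _ => ?_
  rw [subdivision_apply, Finsupp.sum, Finset.smul_sum, Matrix.sum_mulVec]
  refine Finset.sum_congr rfl fun l _ => ?_
  by_cases hs : 2 ∣ l + k - γ
  · have hs' : (2 : ℤ) ∣ 2 * i + γ - k - l := by omega
    rw [if_pos hs, if_pos hs', convₗ_apply, conv, Finsupp.sum_single_index (by simp)]
    rw [Matrix.smul_mulVec, Matrix.mulVec_smul, Matrix.mulVec_mulVec]
    congr 4
    omega
  · have hs' : ¬ (2 : ℤ) ∣ 2 * i + γ - k - l := by omega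
    rw [if_neg hs, if_neg hs']
    simp

lemma conv_dirac {r : ℕ} (u : VecSeq r) : conv (dirac r) u = u := by
  funext j
  rw [conv, Finsupp.sum, Finset.sum_eq_single j]
  · simp [dirac]
  · intro k _ hk
    simp [dirac, sub_eq_zero, hk.symm]
  · intro hj
    simp [Finsupp.notMem_support_iff.mp hj]

/-- All iterated cosets of `u` stay in one finite-dimensional space, so one constant bounds a
functional on all of them. The strict bound on the support of `a` absorbs the shift γ = 1. -/
lemma coset_mem_supported {r : ℕ} {a : Mask r} {N : ℤ} {u : VecSeq r}
    (ha : ∀ l ∈ a.support, |l| < N) (hu : u ∈ Finsupp.supported (Fin r → ℂ) ℂ (Set.Icc (-N) N))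
    {γ : ℤ} (hγ : γ = 0 ∨ γ = 1) :
    coset a γ u ∈ Finsupp.supported (Fin r → ℂ) ℂ (Set.Icc (-N) N) := by
  refine Submodule.sum_mem _ fun l hl => Submodule.sum_mem _ fun k hk => ?_
  dsimp only
  split_ifs with hs
  · refine Finsupp.single_mem_supported ℂ _ ?_
    have h1 := abs_lt.mp (ha l hl)
    have h2 := (Finsupp.mem_supported _ _).mp hu hk
    rw [Set.mem_Icc] at h2 ⊢
    omega
  · exact zero_mem _

/-- The action of `coset` on the Taylor coefficients of `v̂ û` under sum rules. -/
lemma pairing_coset {r m : ℕ} {a : Mask r} {v : VecSeq r} (h : HasSumRules a v m) (γ : ℤ)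
    (u : VecSeq r) :
    PowerSeries.X ^ m ∣ PowerSeries.rescale 2 (pairing v (coset a γ u)) -
      jet (fun ξ => Complex.exp (Complex.I * (γ : ℂ) * (ξ : ℂ))) * pairing v u := by
  have hsc : ContDiff ℝ ∞ fun ξ : ℝ => 2 * ξ := contDiff_const.mul contDiff_id
  have hsh : ContDiff ℝ ∞ fun ξ : ℝ => ξ + Real.pi := contDiff_id.add contDiff_const
  have hE : ContDiff ℝ ∞ fun ξ : ℝ => Complex.exp (Complex.I * (γ : ℂ) * (ξ : ℂ)) :=
    contDiff_exp_mul _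
  have hE' : ContDiff ℝ ∞ fun ξ : ℝ =>
      Complex.exp (Complex.I * (γ : ℂ) * ((ξ + Real.pi : ℝ) : ℂ)) := hE.comp hsh
  have hu := contDiff_symbol u
  have hu' : ContDiff ℝ ∞ fun ξ => symbol u (ξ + Real.pi) := hu.comp hsh
  have hv2 : ContDiff ℝ ∞ fun ξ => symbol v (2 * ξ) := (contDiff_symbol v).comp hsc
  have hF : ContDiff ℝ ∞ fun ξ => symbol v (2 * ξ) ᵥ* symbol a ξ :=
    contDiff_pi.mpr fun i =>
      contDiff_dotProduct hv2 (contDiff_pi.mpr fun j => contDiff_symbol_mask a j i)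
  have hG : ContDiff ℝ ∞ fun ξ => symbol v (2 * ξ) ᵥ* symbol a (ξ + Real.pi) :=
    contDiff_pi.mpr fun i =>
      contDiff_dotProduct hv2 (contDiff_pi.mpr fun j => (contDiff_symbol_mask a j i).comp hsh)
  have key : PowerSeries.rescale 2 (pairing v (coset a γ u)) =
      jet (fun ξ => Complex.exp (Complex.I * (γ : ℂ) * (ξ : ℂ))) *
        jet (fun ξ => (symbol v (2 * ξ) ᵥ* symbol a ξ) ⬝ᵥ symbol u ξ) +
      jet (fun ξ => Complex.exp (Complex.I * (γ : ℂ) * ((ξ + Real.pi : ℝ) : ℂ))) *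
        jet (fun ξ => (symbol v (2 * ξ) ᵥ* symbol a (ξ + Real.pi)) ⬝ᵥ
          symbol u (ξ + Real.pi)) := by
    have h2 := jet_comp_mul
      (contDiff_dotProduct (contDiff_symbol v) (contDiff_symbol (coset a γ u))) 2
    rw [Complex.ofReal_ofNat] at h2
    rw [pairing, ← h2, ← jet_mul hE (contDiff_dotProduct hF hu),
      ← jet_mul hE' (contDiff_dotProduct hG hu'),
      ← jet_add (hE.mul (contDiff_dotProduct hF hu)) (hE'.mul (contDiff_dotProduct hG hu'))]
    congr 1
    funext ξ
    simp only [symbol_coset, dotProduct_add, dotProduct_smul, Matrix.dotProduct_mulVec,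
      smul_eq_mul]
  have hzero : jet (fun _ => 0) = 0 := by simpa using jet_const_mul 0 fun _ => 0
  have h1 := fun i => h.matching.dvd_jet_sub hF (contDiff_symbol v) i
  have h2 := fun i => h.vanishing.dvd_jet_sub hG contDiff_const i
  simp only [Pi.zero_apply, hzero, sub_zero] at h2
  rw [key, jet_dotProduct hF hu, jet_dotProduct hG hu', pairing_eq_sum, add_sub_right_comm,
    ← mul_sub, ← Finset.sum_sub_distrib]
  refine dvd_add (Dvd.dvd.mul_left (Finset.dvd_sum fun i _ => ?_) _)
    (Dvd.dvd.mul_left (Finset.dvd_sum fun i _ => (h2 i).mul_right _) _)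
  rw [← sub_mul]
  exact (h1 i).mul_right _

/-- Rescaling by 2 contributes 2^i. In the Cauchy product with the exponential, whose constant term
is 1, the coefficients of v̂û below i vanish because i ≤ j, so only one term survives. -/
lemma pairingCoeff_coset {r j m : ℕ} {a : Mask r} {v u : VecSeq r} (h : HasSumRules a v m)
    (γ : ℤ) (hu : u ∈ vanishingSpace j v) {i : ℕ} (hij : i ≤ j) (him : i < m) :
    pairingCoeff i v (coset a γ u) = ((2 : ℂ) ^ i)⁻¹ * pairingCoeff i v u := by
  have h1 := PowerSeries.X_pow_dvd_iff.mp (pairing_coset h γ u) i him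
  rw [map_sub, PowerSeries.coeff_rescale, sub_eq_zero, PowerSeries.coeff_mul,
    Finset.sum_eq_single (0, i)] at h1
  · rw [pairingCoeff_apply, pairingCoeff_apply, eq_inv_mul_iff_mul_eq₀ (pow_ne_zero _ two_ne_zero), h1,
      PowerSeries.coeff_zero_eq_constantCoeff_apply, constantCoeff_jet]
    simp
  · rintro ⟨b, c⟩ hbc hne
    rw [Finset.HasAntidiagonal.mem_antidiagonal] at hbc
    have hc : c < j := by
      rcases Nat.eq_zero_or_pos b with rfl | hb
      · exact absurd (by simp_all) hne
      · omega
    rw [← pairingCoeff_apply c, mem_vanishingSpace_iff_pairingCoeff.mp hu c hc, mul_zero]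
  · intro hi
    exact absurd (Finset.HasAntidiagonal.mem_antidiagonal.mpr (zero_add i)) hi

lemma coset_mem_vanishingSpace {r j m : ℕ} {a : Mask r} {v u : VecSeq r} (h : HasSumRules a v m)
    (hjm : j ≤ m) (γ : ℤ) (hu : u ∈ vanishingSpace j v) : coset a γ u ∈ vanishingSpace j v := by
  rw [mem_vanishingSpace_iff_pairingCoeff]
  intro i hi
  rw [pairingCoeff_coset h γ hu hi.le (hi.trans_le hjm),
    mem_vanishingSpace_iff_pairingCoeff.mp hu i hi, mul_zero]

lemma coset_sub_mem_vanishingSpace {r j m : ℕ} {a : Mask r} {v u : VecSeq r}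
    (h : HasSumRules a v m) (hjm : j < m) (γ : ℤ) (hu : u ∈ vanishingSpace j v) :
    coset a γ u - ((2 : ℂ) ^ j)⁻¹ • u ∈ vanishingSpace (j + 1) v := by
  rw [mem_vanishingSpace_iff_pairingCoeff]
  intro i hi
  rw [map_sub, map_smul, smul_eq_mul, pairingCoeff_coset h γ hu (by omega) (by omega)]
  rcases (Nat.lt_succ_iff.mp hi).lt_or_eq with hlt | rfl
  · rw [mem_vanishingSpace_iff_pairingCoeff.mp hu i hlt, mul_zero, mul_zero, sub_zero]
  · exact sub_self _

end

end VectorSubdivision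

namespace VectorSubdivision

open Filter MeasureTheory
open scoped ENNReal

noncomputable section

/-! ### The l_p norm under splitting into even and odd parts -/

section norm

variable {r : ℕ} {p : ℝ≥0∞}

lemma lpNorm_top (w : ℤ → Fin r → ℂ) : lpNorm ∞ w = ⨆ j, ⨆ i, ‖w j i‖ₑ := by
  rw [lpNorm, eLpNorm_exponent_top, eLpNormEssSup_count, iSup_prod]

lemma lpNorm_of_ne_top (hp : p ≠ 0) (hp' : p ≠ ∞) (w : ℤ → Fin r → ℂ) :
    lpNorm p w = (∑' j, ∑ i, ‖w j i‖ₑ ^ p.toReal) ^ (1 / p.toReal) := by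
  rw [lpNorm, eLpNorm_eq_lintegral_rpow_enorm_toReal hp hp', lintegral_count,
    ENNReal.tsum_prod (f := fun j i => ‖w j i‖ₑ ^ p.toReal)]
  simp only [tsum_fintype]

lemma tsum_int_even_odd (f : ℤ → ℝ≥0∞) :
    ∑' j, f j = ∑' j, f (2 * j) + ∑' j, f (2 * j + 1) := by
  rw [← (Int.divModEquiv 2).symm.tsum_eq, ENNReal.tsum_prod']
  simp only [tsum_fintype, Fin.sum_univ_two]
  rw [ENNReal.tsum_add]
  simp [Int.divModEquiv, mul_comm]

/-- The `l_p` norm of a sequence in terms of those of its even and odd parts. -/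
lemma lpNorm_split (hp : p ≠ 0) (hp' : p ≠ ∞) (w : ℤ → Fin r → ℂ) :
    lpNorm p w ^ p.toReal =
      lpNorm p (fun i => w (2 * i)) ^ p.toReal + lpNorm p (fun i => w (2 * i + 1)) ^ p.toReal := by
  have hpos := (ENNReal.toReal_pos hp hp').ne'
  simp only [lpNorm_of_ne_top hp hp', ← ENNReal.rpow_mul, one_div_mul_cancel hpos,
    ENNReal.rpow_one]
  exact tsum_int_even_odd _

lemma lpNorm_top_split (w : ℤ → Fin r → ℂ) :
    lpNorm ∞ w = max (lpNorm ∞ fun i => w (2 * i)) (lpNorm ∞ fun i => w (2 * i + 1)) := by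
  simp only [lpNorm_top]
  refine le_antisymm (iSup_le fun j => ?_) (max_le ?_ ?_)
  · obtain ⟨i, rfl | rfl⟩ := Int.even_or_odd' j
    · exact (le_iSup (fun i => ⨆ c, ‖w (2 * i) c‖ₑ) i).trans (le_max_left _ _)
    · exact (le_iSup (fun i => ⨆ c, ‖w (2 * i + 1) c‖ₑ) i).trans (le_max_right _ _)
  · exact iSup_le fun i => le_iSup (fun j => ⨆ c, ‖w j c‖ₑ) (2 * i)
  · exact iSup_le fun i => le_iSup (fun j => ⨆ c, ‖w j c‖ₑ) (2 * i + 1)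

lemma lpNorm_add_le (hp : 1 ≤ p) (w z : ℤ → Fin r → ℂ) :
    lpNorm p (w + z) ≤ lpNorm p w + lpNorm p z :=
  eLpNorm_add_le (f := fun q : ℤ × Fin r => w q.1 q.2) (g := fun q : ℤ × Fin r => z q.1 q.2)
    .of_discrete .of_discrete hp

lemma lpNorm_const_smul (c : ℂ) (w : ℤ → Fin r → ℂ) :
    lpNorm p (c • w) = ‖c‖ₑ * lpNorm p w :=
  eLpNorm_const_smul c (fun q : ℤ × Fin r => w q.1 q.2) p _

/-- `2 ^ (1 / p)`, the norm of doubling in `l_p`. -/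
def dbl (p : ℝ≥0∞) : ℝ≥0∞ := 2 ^ (1 / p).toReal

lemma dbl_top : dbl ∞ = 1 := by simp [dbl]

lemma dbl_rpow (hp : p ≠ 0) (hp' : p ≠ ∞) : dbl p ^ p.toReal = 2 := by
  have hpos := (ENNReal.toReal_pos hp hp').ne'
  rw [dbl, ← ENNReal.rpow_mul]
  simp [hpos]

lemma dbl_ne_top : dbl p ≠ ∞ := ENNReal.rpow_ne_top_of_nonneg ENNReal.toReal_nonneg (by simp)

lemma dbl_mul_le_lpNorm (hp : p ≠ 0) {c : ℝ≥0∞} {w : ℤ → Fin r → ℂ}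
    (h0 : c ≤ lpNorm p fun i => w (2 * i)) (h1 : c ≤ lpNorm p fun i => w (2 * i + 1)) :
    dbl p * c ≤ lpNorm p w := by
  by_cases hp' : p = ∞
  · subst hp'
    rw [dbl_top, one_mul, lpNorm_top_split]
    exact h0.trans (le_max_left _ _)
  · have hpos := ENNReal.toReal_pos hp hp'
    rw [← ENNReal.rpow_le_rpow_iff hpos, ENNReal.mul_rpow_of_nonneg _ _ hpos.le, dbl_rpow hp hp',
      lpNorm_split hp hp' w, two_mul]
    gcongr

/-- A sequence whose even and odd parts coincide. -/
lemma lpNorm_eq_dbl_mul (hp : p ≠ 0) {w : ℤ → Fin r → ℂ}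
    (h : (fun i => w (2 * i)) = fun i => w (2 * i + 1)) :
    lpNorm p w = dbl p * lpNorm p (fun i => w (2 * i)) := by
  by_cases hp' : p = ∞
  · subst hp'
    rw [dbl_top, one_mul, lpNorm_top_split, ← h, max_self]
  · have hpos := ENNReal.toReal_pos hp hp'
    rw [← (ENNReal.rpow_left_injective hpos.ne').eq_iff, ENNReal.mul_rpow_of_nonneg _ _ hpos.le, dbl_rpow hp hp',
      lpNorm_split hp hp' w, two_mul, ← h]

lemma lpNorm_le_add (hp : 1 ≤ p) (w : ℤ → Fin r → ℂ) :
    lpNorm p w ≤ lpNorm p (fun i => w (2 * i)) + lpNorm p (fun i => w (2 * i + 1)) := by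
  by_cases hp' : p = ∞
  · subst hp'
    rw [lpNorm_top_split]
    exact max_le_add_of_nonneg zero_le zero_le
  · have hp0 := (one_pos.trans_le hp).ne'
    have hpos := ENNReal.toReal_pos hp0 hp'
    have h1 : 1 ≤ p.toReal := by
      simpa using (ENNReal.toReal_le_toReal ENNReal.one_ne_top hp').mpr hp
    rw [← ENNReal.rpow_le_rpow_iff hpos, lpNorm_split hp0 hp' w]
    exact ENNReal.add_rpow_le_rpow_add _ _ h1

/-- Interleaving `y + z₀` and `y + z₁`. -/
lemma lpNorm_le_of_split (hp : 1 ≤ p) {w y z₀ z₁ : ℤ → Fin r → ℂ}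
    (h0 : (fun i => w (2 * i)) = y + z₀) (h1 : (fun i => w (2 * i + 1)) = y + z₁) :
    lpNorm p w ≤ dbl p * lpNorm p y + (lpNorm p z₀ + lpNorm p z₁) := by
  have hp0 := (one_pos.trans_le hp).ne'
  -- `Y` repeats each entry of `y` twice, so its norm is exactly 2^(1/p) times that of `y`; a
  -- triangle inequality over the two cosets would only give the factor 2.
  let Y : ℤ → Fin r → ℂ := fun j => y (j / 2)
  have e0 : ∀ i : ℤ, 2 * i / 2 = i := fun i => by omega
  have e1 : ∀ i : ℤ, (2 * i + 1) / 2 = i := fun i => by omega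
  have hY0 : (fun i => Y (2 * i)) = y := by simp [Y, e0]
  have hY1 : (fun i => Y (2 * i + 1)) = y := by simp [Y, e1]
  have hw : w = Y + (w - Y) := by abel
  rw [hw]
  refine (lpNorm_add_le hp _ _).trans (add_le_add ?_ ?_)
  · rw [lpNorm_eq_dbl_mul hp0 (hY0.trans hY1.symm), hY0]
  · refine (lpNorm_le_add hp _).trans_eq ?_
    congr 2
    · funext i
      have h : w (2 * i) = y i + z₀ i := congrFun h0 i
      simp [Y, e0, h]
    · funext i
      have h : w (2 * i + 1) = y i + z₁ i := congrFun h1 i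
      simp [Y, e1, h]

lemma enorm_le_lpNorm (hp : p ≠ 0) (w : ℤ → Fin r → ℂ) (j : ℤ) (i : Fin r) :
    ‖w j i‖ₑ ≤ lpNorm p w :=
  enorm_le_eLpNorm_count (fun q : ℤ × Fin r => w q.1 q.2) (j, i) hp

lemma lpNorm_coe_ne_top (hp : p ≠ 0) (u : VecSeq r) : lpNorm p u ≠ ∞ := by
  by_cases hp' : p = ∞
  · subst hp'
    have h : lpNorm ∞ u ≤ ∑ j ∈ u.support, ∑ i, ‖u j i‖ₑ := by
      rw [lpNorm_top]
      refine iSup₂_le fun j i => ?_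
      by_cases hj : j ∈ u.support
      · exact (Finset.single_le_sum (f := fun i => ‖u j i‖ₑ) (fun _ _ => zero_le)
          (Finset.mem_univ i)).trans (Finset.single_le_sum (f := fun j => ∑ i, ‖u j i‖ₑ)
          (fun _ _ => zero_le) hj)
      · simp [Finsupp.notMem_support_iff.mp hj]
    exact ne_top_of_le_ne_top (by simp) h
  · have hpos := ENNReal.toReal_pos hp hp'
    rw [lpNorm_of_ne_top hp hp', tsum_eq_sum (s := u.support)]
    · refine ENNReal.rpow_ne_top_of_nonneg (by positivity) ?_
      simp [ENNReal.sum_eq_top, ENNReal.rpow_eq_top_iff, hpos.le]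
    · intro j hj
      simp [Finsupp.notMem_support_iff.mp hj, hpos]

lemma exists_bound_of_supported (hp : p ≠ 0) (φ : VecSeq r →ₗ[ℂ] ℂ) (N : ℤ) :
    ∃ C : ℝ≥0∞, C ≠ ∞ ∧ ∀ u ∈ Finsupp.supported (Fin r → ℂ) ℂ (Set.Icc (-N) N),
      ‖φ u‖ₑ ≤ C * lpNorm p u := by
  refine ⟨∑ k ∈ Finset.Icc (-N) N, ∑ i, ‖φ (Finsupp.single k (Pi.single i 1))‖ₑ,
    by simp, fun u hu => ?_⟩
  have hsub : u.support ⊆ Finset.Icc (-N) N := by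
    simpa [Finsupp.mem_supported, ← Finset.coe_Icc] using hu
  have hu' : u = ∑ k ∈ Finset.Icc (-N) N, ∑ i,
      u k i • (Finsupp.single k (Pi.single i 1) : VecSeq r) := by
    conv_lhs => rw [← u.sum_single, Finsupp.sum_of_support_subset _ hsub _ (by simp)]
    refine Finset.sum_congr rfl fun k _ => ?_
    conv_lhs => rw [pi_eq_sum_univ' (u k)]
    rw [Finsupp.single_finsetSum]
    simp only [Finsupp.smul_single]
  have hφ : φ u = ∑ k ∈ Finset.Icc (-N) N, ∑ i,
      u k i * φ (Finsupp.single k (Pi.single i 1)) := by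
    conv_lhs => rw [hu']
    simp only [map_sum, map_smul, smul_eq_mul]
  rw [hφ, Finset.sum_mul]
  refine (enorm_sum_le _ _).trans (Finset.sum_le_sum fun k _ => ?_)
  rw [Finset.sum_mul]
  refine (enorm_sum_le _ _).trans (Finset.sum_le_sum fun i _ => ?_)
  rw [enorm_mul, mul_comm]
  gcongr
  exact enorm_le_lpNorm hp u k i

end norm

end

end VectorSubdivision

namespace VectorSubdivision

open Filter MeasureTheory
open scoped ENNReal

noncomputable section

/-! ### Growth rates: upper bound, lower bound, independence of the filter -/

section growth

variable {r : ℕ} {p : ℝ≥0∞} {a : Mask r}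

/-- The norm `‖(S_a^n (δ I_r)) * u‖_p`. -/
def levelNorm (a : Mask r) (p : ℝ≥0∞) (u : VecSeq r) (n : ℕ) : ℝ≥0∞ :=
  lpNorm p (conv ((subdivision a)^[n] (dirac r)) u)

/-- The exponential growth rate of `‖(S_a^n (δ I_r)) * u‖_p`. -/
def growth (a : Mask r) (p : ℝ≥0∞) (u : VecSeq r) : ℝ≥0∞ :=
  limsup (fun n : ℕ => levelNorm a p u n ^ (1 / (n : ℝ))) atTop

lemma rho_eq_iSup_growth (j : ℕ) (v : VecSeq r) :
    rho j a v p = ⨆ u ∈ vanishingSpace j v, growth a p u := rfl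

lemma growth_le_rho {j : ℕ} {u v : VecSeq r} (hu : u ∈ vanishingSpace j v) :
    growth a p u ≤ rho j a v p :=
  le_iSup₂ (f := fun u (_ : u ∈ vanishingSpace j v) => growth a p u) u hu

lemma levelNorm_zero (u : VecSeq r) : levelNorm a p u 0 = lpNorm p u := by
  rw [levelNorm, Function.iterate_zero_apply, conv_dirac]

lemma conv_iterate_succ (u : VecSeq r) (n : ℕ) (γ i : ℤ) :
    conv ((subdivision a)^[n + 1] (dirac r)) u (2 * i + γ) =
      conv ((subdivision a)^[n] (dirac r)) (coset a γ u) i := by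
  rw [Function.iterate_succ_apply', conv_subdivision]

lemma conv_iterate_succ_even (u : VecSeq r) (n : ℕ) :
    (fun i => conv ((subdivision a)^[n + 1] (dirac r)) u (2 * i)) =
      conv ((subdivision a)^[n] (dirac r)) (coset a 0 u) := by
  funext i
  simpa using conv_iterate_succ (a := a) u n 0 i

lemma conv_iterate_succ_odd (u : VecSeq r) (n : ℕ) :
    (fun i => conv ((subdivision a)^[n + 1] (dirac r)) u (2 * i + 1)) =
      conv ((subdivision a)^[n] (dirac r)) (coset a 1 u) :=
  funext fun i => conv_iterate_succ (a := a) u n 1 i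

lemma levelNorm_ne_top (hp : 1 ≤ p) (u : VecSeq r) (n : ℕ) : levelNorm a p u n ≠ ∞ := by
  induction n generalizing u with
  | zero =>
    rw [levelNorm_zero]
    exact lpNorm_coe_ne_top (one_pos.trans_le hp).ne' u
  | succ n ih =>
    have h := lpNorm_le_add hp (conv ((subdivision a)^[n + 1] (dirac r)) u)
    rw [conv_iterate_succ_even, conv_iterate_succ_odd] at h
    exact ne_top_of_le_ne_top (ENNReal.add_ne_top.mpr ⟨ih _, ih _⟩) h

lemma levelNorm_succ_le (hp : 1 ≤ p) (u : VecSeq r) (c : ℂ) (n : ℕ) :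
    levelNorm a p u (n + 1) ≤ dbl p * ‖c‖ₑ * levelNorm a p u n +
      (levelNorm a p (coset a 0 u - c • u) n + levelNorm a p (coset a 1 u - c • u) n) := by
  rw [mul_assoc]
  unfold levelNorm
  rw [← lpNorm_const_smul]
  refine lpNorm_le_of_split hp ?_ ?_
  · rw [conv_iterate_succ_even]
    simp only [← convₗ_apply, map_sub, map_smul, add_sub_cancel]
  · rw [conv_iterate_succ_odd]
    simp only [← convₗ_apply, map_sub, map_smul, add_sub_cancel]

lemma levelNorm_succ_ge (hp : p ≠ 0) (u : VecSeq r) (n : ℕ) {c : ℝ≥0∞}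
    (h0 : c ≤ levelNorm a p (coset a 0 u) n) (h1 : c ≤ levelNorm a p (coset a 1 u) n) :
    dbl p * c ≤ levelNorm a p u (n + 1) := by
  refine dbl_mul_le_lpNorm hp (w := conv ((subdivision a)^[n + 1] (dirac r)) u) ?_ ?_
  · exact h0.trans_eq (congrArg (lpNorm p) (conv_iterate_succ_even u n).symm)
  · exact h1.trans_eq (congrArg (lpNorm p) (conv_iterate_succ_odd u n).symm)

lemma exists_levelNorm_le_of_growth_lt (hp : 1 ≤ p) {u : VecSeq r} {M : ℝ≥0∞}
    (h : growth a p u < M) (hM : M ≠ ∞) : ∃ C : ℝ≥0∞, C ≠ ∞ ∧ ∀ n, levelNorm a p u n ≤ C * M ^ n := by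
  have hM0 : M ≠ 0 := (zero_le.trans_lt h).ne'
  obtain ⟨N, hN⟩ := eventually_atTop.mp
    ((eventually_lt_of_limsup_lt h).and (eventually_ge_atTop 1))
  -- The summand 1 serves the tail n ≥ N; the sum absorbs the finitely many earlier levels.
  refine ⟨1 + ∑ n ∈ Finset.range N, levelNorm a p u n / M ^ n, ?_, fun n => ?_⟩
  · simp [ENNReal.sum_eq_top, ENNReal.div_eq_top, levelNorm_ne_top hp, hM0]
  · rcases lt_or_ge n N with hn | hn
    · calc levelNorm a p u n = levelNorm a p u n / M ^ n * M ^ n :=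
            (ENNReal.div_mul_cancel (pow_ne_zero _ hM0) (ENNReal.pow_ne_top hM)).symm
        _ ≤ _ := by
          gcongr
          exact (Finset.single_le_sum (f := fun n => levelNorm a p u n / M ^ n)
            (fun _ _ => zero_le) (Finset.mem_range.mpr hn)).trans le_add_self
    · obtain ⟨h1, h2⟩ := hN n hn
      have hn0 : (0 : ℝ) < n := by exact_mod_cast h2
      rw [one_div] at h1
      have h3 := (ENNReal.rpow_inv_le_iff hn0).mp h1.le
      rw [ENNReal.rpow_natCast] at h3
      refine h3.trans ?_
      conv_lhs => rw [← one_mul (M ^ n)]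
      gcongr
      exact le_self_add

lemma tendsto_const_mul_div_pow {C M M' : ℝ≥0∞} (hC : C ≠ ∞) (h : M < M') :
    Tendsto (fun n : ℕ => C * (M / M') ^ n) atTop (nhds 0) := by
  have hlt : M / M' < 1 := by
    rw [ENNReal.div_lt_iff (Or.inl (zero_le.trans_lt h).ne') (Or.inr h.ne_top), one_mul]
    exact h
  simpa using ENNReal.Tendsto.const_mul
    (ENNReal.tendsto_pow_atTop_nhds_zero_of_lt_one hlt) (Or.inr hC)

lemma growth_le_of_levelNorm_le {u : VecSeq r} {C M M' : ℝ≥0∞} (hC : C ≠ ∞) (hM : M < M')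
    (h : ∀ n, levelNorm a p u n ≤ C * M ^ n) : growth a p u ≤ M' := by
  by_cases hM' : M' = ∞
  · exact hM' ▸ le_top
  have hM0 : M' ≠ 0 := (zero_le.trans_lt hM).ne'
  refine limsup_le_of_le (by isBoundedDefault) ?_
  filter_upwards [(tendsto_const_mul_div_pow hC hM).eventually_le_const one_pos,
    eventually_ge_atTop 1] with n hn hn1
  have hn0 : (0 : ℝ) < n := by exact_mod_cast hn1
  rw [one_div, ENNReal.rpow_inv_le_iff hn0, ENNReal.rpow_natCast]
  calc levelNorm a p u n ≤ C * M ^ n := h n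
    _ = C * (M / M') ^ n * M' ^ n := by
      rw [mul_assoc, ← mul_pow, ENNReal.div_mul_cancel hM0 hM']
    _ ≤ 1 * M' ^ n := by gcongr
    _ = M' ^ n := one_mul _

/-- If both cosets of `u` differ from `c u` by sequences of growth at most `R`, then `u` has growth
at most `max R (2 ^ (1 / p) |c|)`. -/
lemma growth_le_max (hp : 1 ≤ p) {u : VecSeq r} {c : ℂ} {R : ℝ≥0∞}
    (h0 : growth a p (coset a 0 u - c • u) ≤ R) (h1 : growth a p (coset a 1 u - c • u) ≤ R) :
    growth a p u ≤ max R (dbl p * ‖c‖ₑ) := by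
  refine le_of_forall_gt_imp_ge_of_dense fun M' hM' => ?_
  obtain ⟨M, hM, hMM'⟩ := exists_between hM'
  obtain ⟨hRM, hcM⟩ := max_lt_iff.mp hM
  have hMt : M ≠ ∞ := hMM'.ne_top
  obtain ⟨C₀, hC₀, hb₀⟩ := exists_levelNorm_le_of_growth_lt hp (h0.trans_lt hRM) hMt
  obtain ⟨C₁, hC₁, hb₁⟩ := exists_levelNorm_le_of_growth_lt hp (h1.trans_lt hRM) hMt
  set l := dbl p * ‖c‖ₑ with hl
  have hd : M - l ≠ 0 := (tsub_pos_of_lt hcM).ne'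
  have hdt : M - l ≠ ∞ := ENNReal.sub_ne_top hMt
  -- `D` is large enough for the bound `D * M ^ n` to reproduce itself under the recursion with
  -- factor `l` < `M` and forcing `(C₀ + C₁) * M ^ n`.
  set D := levelNorm a p u 0 + (C₀ + C₁) / (M - l) with hD
  have hDt : D ≠ ∞ := ENNReal.add_ne_top.mpr ⟨levelNorm_ne_top hp u 0,
    ENNReal.div_ne_top (ENNReal.add_ne_top.mpr ⟨hC₀, hC₁⟩) hd⟩
  have hstep : l * D + (C₀ + C₁) ≤ D * M := by
    calc l * D + (C₀ + C₁) = l * D + (C₀ + C₁) / (M - l) * (M - l) := by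
          rw [ENNReal.div_mul_cancel hd hdt]
      _ ≤ l * D + D * (M - l) := by
          gcongr
          exact le_add_self
      _ = D * M := by
          rw [mul_comm l D, ← mul_add, add_tsub_cancel_of_le hcM.le]
  refine growth_le_of_levelNorm_le hDt hMM' fun n => ?_
  induction n with
  | zero =>
    rw [pow_zero, mul_one]
    exact le_self_add
  | succ n ih =>
    calc levelNorm a p u (n + 1)
        ≤ l * (D * M ^ n) + (C₀ * M ^ n + C₁ * M ^ n) := by
          refine (levelNorm_succ_le hp u c n).trans ?_
          gcongr
          · exact hb₀ n
          · exact hb₁ n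
      _ = (l * D + (C₀ + C₁)) * M ^ n := by ring
      _ ≤ D * M * M ^ n := by gcongr
      _ = D * M ^ (n + 1) := by ring

/-- `2 ^ (1 / p - j)`, the growth rate on the Taylor coefficient of order `j`. -/
def rate (p : ℝ≥0∞) (j : ℕ) : ℝ≥0∞ := dbl p * (2 ^ j)⁻¹

lemma rate_anti {j k : ℕ} (h : j ≤ k) : rate p k ≤ rate p j := by
  unfold rate
  gcongr
  exact one_le_two

lemma enorm_inv_two_pow (j : ℕ) : ‖((2 : ℂ) ^ j)⁻¹‖ₑ = (2 ^ j)⁻¹ := by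
  have h2 : ‖(2 : ℂ)‖ₑ = 2 := by
    rw [← ofReal_norm]
    simp
  rw [enorm_inv (pow_ne_zero _ two_ne_zero), enorm_pow, h2]

lemma rho_le_max_succ (hp : 1 ≤ p) {v : VecSeq r} {j m : ℕ} (h : HasSumRules a v m)
    (hjm : j < m) : rho j a v p ≤ max (rho (j + 1) a v p) (rate p j) := by
  rw [rho_eq_iSup_growth]
  refine iSup₂_le fun u hu => ?_
  rw [rate, ← enorm_inv_two_pow]
  exact growth_le_max hp (growth_le_rho (coset_sub_mem_vanishingSpace h hjm 0 hu))
    (growth_le_rho (coset_sub_mem_vanishingSpace h hjm 1 hu))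

lemma rho_le_max (hp : 1 ≤ p) {v : VecSeq r} {j k : ℕ} (h : HasSumRules a v k)
    (hjk : j ≤ k) : rho j a v p ≤ max (rho k a v p) (rate p j) := by
  suffices H : ∀ i, j ≤ i → i ≤ k → rho j a v p ≤ max (rho i a v p) (rate p j) from H k hjk le_rfl
  intro i hi
  induction i, hi using Nat.le_induction with
  | base => exact fun _ => le_max_left _ _
  | succ i hi ih =>
    intro hik
    refine (ih (by omega)).trans (max_le ?_ (le_max_right _ _))
    -- The rates decrease with the order, so the first one dominates all later ones.
    exact (rho_le_max_succ hp h hik).trans (max_le_max le_rfl (rate_anti hi))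

lemma rho_anti {v : VecSeq r} {j k : ℕ} (h : j ≤ k) : rho k a v p ≤ rho j a v p :=
  iSup₂_le fun _ hu => growth_le_rho (vanishingSpace_anti v h hu)

lemma exists_supported (a : Mask r) (u : VecSeq r) :
    ∃ N : ℤ, (∀ l ∈ a.support, |l| < N) ∧
      u ∈ Finsupp.supported (Fin r → ℂ) ℂ (Set.Icc (-N) N) := by
  refine ⟨∑ l ∈ a.support, |l| + ∑ k ∈ u.support, |k| + 1, fun l hl => ?_, ?_⟩
  · have h1 := Finset.single_le_sum (f := fun l : ℤ => |l|) (fun _ _ => abs_nonneg _) hl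
    have h2 := Finset.sum_nonneg (s := u.support) fun k _ => abs_nonneg k
    linarith
  · rw [Finsupp.mem_supported]
    intro k hk
    have h1 := Finset.single_le_sum (f := fun l : ℤ => |l|) (fun _ _ => abs_nonneg _) hk
    have h2 := Finset.sum_nonneg (s := a.support) fun k _ => abs_nonneg k
    rw [Set.mem_Icc, ← abs_le]
    linarith

/-- A nonzero Taylor coefficient of `v̂ û` of order `j` forces growth at least `2 ^ (1 / p - j)`. -/
lemma rate_le_growth (hp : 1 ≤ p) {v u : VecSeq r} {j m : ℕ} (h : HasSumRules a v m)
    (hjm : j < m) (hu : u ∈ vanishingSpace j v) (hu' : u ∉ vanishingSpace (j + 1) v) :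
    rate p j ≤ growth a p u := by
  have hp0 := (one_pos.trans_le hp).ne'
  have hne : pairingCoeff j v u ≠ 0 := by
    intro h0
    refine hu' (mem_vanishingSpace_iff_pairingCoeff.mpr fun i hi => ?_)
    rcases (Nat.lt_succ_iff.mp hi).lt_or_eq with hlt | rfl
    · exact mem_vanishingSpace_iff_pairingCoeff.mp hu i hlt
    · exact h0
  obtain ⟨N, haN, huN⟩ := exists_supported a u
  obtain ⟨C, hC, hbound⟩ := exists_bound_of_supported hp0 (pairingCoeff j v) N
  -- Each step multiplies the coefficient by 2^(-j) on both cosets and the norm gains 2^(1/p), while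
  -- `C` stays fixed because the supports stay in [-N, N].
  have lower : ∀ n, ∀ w ∈ Finsupp.supported (Fin r → ℂ) ℂ (Set.Icc (-N) N),
      w ∈ vanishingSpace j v → rate p j ^ n * ‖pairingCoeff j v w‖ₑ ≤ C * levelNorm a p w n := by
    intro n
    induction n with
    | zero =>
      intro w hw _
      rw [pow_zero, one_mul, levelNorm_zero]
      exact hbound w hw
    | succ n ih =>
      intro w hw hwj
      have hcoset : ∀ γ : ℤ, γ = 0 ∨ γ = 1 →
          rate p j ^ n * ((2 ^ j)⁻¹ * ‖pairingCoeff j v w‖ₑ) ≤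
            C * levelNorm a p (coset a γ w) n := by
        intro γ hγ
        have h1 := ih (coset a γ w) (coset_mem_supported haN hw hγ)
          (coset_mem_vanishingSpace h hjm.le γ hwj)
        rwa [pairingCoeff_coset h γ hwj le_rfl hjm, enorm_mul, enorm_inv_two_pow] at h1
      have h2 := levelNorm_succ_ge hp0 w n (min_le_left (levelNorm a p (coset a 0 w) n)
        (levelNorm a p (coset a 1 w) n)) (min_le_right _ _)
      calc rate p j ^ (n + 1) * ‖pairingCoeff j v w‖ₑ
          = dbl p * (rate p j ^ n * ((2 ^ j)⁻¹ * ‖pairingCoeff j v w‖ₑ)) := by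
            rw [pow_succ]
            conv_lhs => rw [rate.eq_def p j]
            rw [rate]
            ring
        _ ≤ dbl p * (C * min (levelNorm a p (coset a 0 w) n)
              (levelNorm a p (coset a 1 w) n)) := by
            gcongr dbl p * ?_
            rcases min_choice (levelNorm a p (coset a 0 w) n)
              (levelNorm a p (coset a 1 w) n) with hm | hm <;> rw [hm]
            · exact hcoset 0 (Or.inl rfl)
            · exact hcoset 1 (Or.inr rfl)
        _ = C * (dbl p * min (levelNorm a p (coset a 0 w) n)
              (levelNorm a p (coset a 1 w) n)) := by ring
        _ ≤ C * levelNorm a p w (n + 1) := by gcongr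
  by_contra! hlt
  obtain ⟨M, hM, hMr⟩ := exists_between hlt
  obtain ⟨C', hC', hb⟩ := exists_levelNorm_le_of_growth_lt hp hM hMr.ne_top
  have hr0 : rate p j ≠ 0 := (zero_le.trans_lt hMr).ne'
  have hrt : rate p j ≠ ∞ := ENNReal.mul_ne_top dbl_ne_top (by simp)
  -- Growth below the rate would bound the fixed nonzero coefficient by a sequence tending to 0.
  have hle : ∀ n : ℕ, ‖pairingCoeff j v u‖ₑ ≤ C * C' * (M / rate p j) ^ n := by
    intro n
    rw [← ENNReal.mul_le_mul_iff_right (pow_ne_zero n hr0) (ENNReal.pow_ne_top hrt)]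
    calc rate p j ^ n * ‖pairingCoeff j v u‖ₑ ≤ C * levelNorm a p u n := lower n u huN hu
      _ ≤ C * (C' * M ^ n) := by
        gcongr
        exact hb n
      _ = C * (C' * (M / rate p j * rate p j) ^ n) := by rw [ENNReal.div_mul_cancel hr0 hrt]
      _ = rate p j ^ n * (C * C' * (M / rate p j) ^ n) := by
        rw [mul_pow]
        ring
  have h0 := ge_of_tendsto' (tendsto_const_mul_div_pow (ENNReal.mul_ne_top hC hC') hMr) hle
  exact hne (enorm_eq_zero.mp (nonpos_iff_eq_zero.mp h0))

lemma rho_le_rho (hp : 1 ≤ p) {v v' : VecSeq r} {k : ℕ} (h : HasSumRules a v k)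
    (h' : HasSumRules a v' k) : rho k a v p ≤ rho k a v' p := by
  by_cases hk : vanishingSpace k v ⊆ vanishingSpace k v'
  · exact iSup₂_le fun u hu => growth_le_rho (hk hu)
  -- The last order at which the inclusion holds; order 0 imposes no condition.
  obtain ⟨j, hjk, hj, hj'⟩ : ∃ j < k, vanishingSpace k v ⊆ vanishingSpace j v' ∧
      ¬ vanishingSpace k v ⊆ vanishingSpace (j + 1) v' := by
    by_contra! H
    have : ∀ j ≤ k, vanishingSpace k v ⊆ vanishingSpace j v' := by
      intro j
      induction j with
      | zero => exact fun _ u _ => mem_vanishingSpace.mpr (by simp)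
      | succ j ih => exact fun hj => H j hj (ih (by omega))
    exact hk (this k le_rfl)
  have hsub := vanishingSpace_subset_symm hjk.le h'.symbol_zero_ne hj
  obtain ⟨u, hu, hu'⟩ := Set.not_subset.mp
    (fun H => hj' (vanishingSpace_subset_symm hjk h.symbol_zero_ne H))
  have hrate : rate p j ≤ rho k a v' p :=
    (rate_le_growth hp h hjk (hsub hu) hu').trans (growth_le_rho hu)
  calc rho k a v p ≤ rho j a v' p := iSup₂_le fun u hu => growth_le_rho (hj hu)
    _ ≤ max (rho k a v' p) (rate p j) := rho_le_max hp h' hjk.le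
    _ ≤ rho k a v' p := max_le le_rfl hrate

/-- The joint growth rate does not depend on the matching filter. -/
lemma rho_eq_rho (hp : 1 ≤ p) {v v' : VecSeq r} {k : ℕ} (h : HasSumRules a v k)
    (h' : HasSumRules a v' k) : rho k a v p = rho k a v' p :=
  le_antisymm (rho_le_rho hp h h') (rho_le_rho hp h' h)

lemma HasSumRules.mono {v : VecSeq r} {k m : ℕ} (h : HasSumRules a v m) (hkm : k ≤ m) :
    HasSumRules a v k :=
  ⟨h.symbol_zero_ne, fun j hj => h.matching j (hj.trans_le hkm),
    fun j hj => h.vanishing j (hj.trans_le hkm)⟩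

/-- Since `ϑ` also serves at order k, `v` may be replaced by it; the layers between k and m then
contribute at most `rate p k`. -/
lemma rho_eq_rho_of_rate_le (hp : 1 ≤ p) {v ϑ : VecSeq r} {k m : ℕ} (hϑ : HasSumRules a ϑ m)
    (hkm : k ≤ m) (hv : HasSumRules a v k) (hrate : rate p k ≤ rho m a ϑ p) :
    rho k a v p = rho m a ϑ p := by
  rw [rho_eq_rho hp hv (hϑ.mono hkm)]
  exact le_antisymm ((rho_le_max hp hϑ hkm).trans (max_le le_rfl hrate)) (rho_anti hkm)

end growth

/-! ### Translation between growth rates and smoothness exponents -/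

section log

lemma log_two_pos : (0 : ℝ) < Real.log 2 := Real.log_pos one_lt_two

lemma exp2_log2 (x : ℝ≥0∞) : exp2 (log2 x) = x := by
  rw [exp2, log2, EReal.div_mul_cancel (EReal.coe_ne_bot _) (EReal.coe_ne_top _)
    (by exact_mod_cast log_two_pos.ne'), ENNReal.exp_log]

lemma log2_exp2 (x : EReal) : log2 (exp2 x) = x := by
  rw [exp2, log2, EReal.log_exp, ← EReal.mul_div_right,
    EReal.div_mul_cancel (EReal.coe_ne_bot _) (EReal.coe_ne_top _)
    (by exact_mod_cast log_two_pos.ne')]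

lemma log2_strictMono : StrictMono log2 := fun _ _ h =>
  EReal.strictMono_div_right_of_pos (by exact_mod_cast log_two_pos) (EReal.coe_ne_top _)
    (ENNReal.log_strictMono h)

lemma recip_eq_coe {p : ℝ≥0∞} (hp : 1 ≤ p) : recip p = ((1 / p).toReal : ℝ) := by
  have h : 1 / p ≠ ∞ := by simpa using (one_pos.trans_le hp).ne'
  rw [recip, EReal.coe_ennreal_toReal h]

lemma rate_eq_exp2 (p : ℝ≥0∞) (j : ℕ) : rate p j = exp2 (((1 / p).toReal - j : ℝ) : EReal) := by
  rw [exp2, ← EReal.coe_mul, EReal.exp_coe, sub_mul, Real.exp_sub, rate, dbl, div_eq_mul_inv (Real.exp _),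
    ENNReal.ofReal_mul (Real.exp_nonneg _), ENNReal.ofReal_inv_of_pos (Real.exp_pos _)]
  congr 2
  · rw [mul_comm, ← Real.rpow_def_of_pos two_pos, ← ENNReal.ofReal_rpow_of_pos two_pos]
    simp
  · rw [mul_comm, ← Real.rpow_def_of_pos two_pos, Real.rpow_natCast,
      ENNReal.ofReal_pow zero_le_two]
    simp

lemma recip_sub_recip_sub {p : ℝ≥0∞} (hp : 1 ≤ p) (x : EReal) : recip p - (recip p - x) = x := by
  rw [recip_eq_coe hp]
  induction x with
  | bot => simp
  | top => simp
  | coe x =>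
    rw [← EReal.coe_sub, ← EReal.coe_sub]
    congr 1
    ring

lemma rate_le_of_recip_sub_le {p : ℝ≥0∞} (hp : 1 ≤ p) {x : ℝ≥0∞} {k : ℕ}
    (h : recip p - log2 x ≤ (k : EReal)) : rate p k ≤ x := by
  rw [← log2_strictMono.le_iff_le, rate_eq_exp2, log2_exp2]
  rw [recip_eq_coe hp] at h
  have hk : (k : EReal) = ((k : ℝ) : EReal) := rfl
  rw [hk] at h
  generalize log2 x = y at h
  induction y with
  -- Here x = 0, so the smoothness exponent is ∞ and no integer k can bound it.
  | bot => exact absurd (by simpa using h) (EReal.natCast_ne_top k)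
  | top => exact le_top
  | coe y =>
    rw [← EReal.coe_sub, EReal.coe_le_coe_iff] at h
    exact EReal.coe_le_coe_iff.mpr (by linarith)

end log

end

end VectorSubdivision

theorem mainTheorem4 {r : ℕ} (hr : 1 ≤ r) (a : VectorSubdivision.Mask r)
    (p : ENNReal) (hp : 1 ≤ p) :
    (∀ ϑ ϑ' : VectorSubdivision.VecSeq r,
      VectorSubdivision.HasSumRules a ϑ (VectorSubdivision.sr a) →
      VectorSubdivision.HasSumRules a ϑ' (VectorSubdivision.sr a) →
      VectorSubdivision.sm a ϑ p = VectorSubdivision.sm a ϑ' p) ∧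
    (∀ ϑ : VectorSubdivision.VecSeq r,
      VectorSubdivision.HasSumRules a ϑ (VectorSubdivision.sr a) →
      ∀ (v : VectorSubdivision.VecSeq r) (k : ℕ),
        VectorSubdivision.sm a ϑ p ≤ (k : EReal) →
        k ≤ VectorSubdivision.sr a →
        VectorSubdivision.HasSumRules a v k →
        VectorSubdivision.rho k a v p =
            VectorSubdivision.exp2
              (VectorSubdivision.recip p - VectorSubdivision.sm a ϑ p) ∧
          VectorSubdivision.sm a ϑ p =
            VectorSubdivision.recip p -
              VectorSubdivision.log2 (VectorSubdivision.rho k a v p)) := by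
  refine ⟨fun ϑ ϑ' h h' => ?_, fun ϑ h v k hsm hk hv => ?_⟩
  · rw [VectorSubdivision.sm, VectorSubdivision.sm, VectorSubdivision.rho_eq_rho hp h h']
  · have hrho := VectorSubdivision.rho_eq_rho_of_rate_le hp h hk hv
      (VectorSubdivision.rate_le_of_recip_sub_le hp hsm)
    rw [VectorSubdivision.sm, hrho, VectorSubdivision.recip_sub_recip_sub hp,
      VectorSubdivision.exp2_log2]
    exact ⟨rfl, rfl⟩
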